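/- Let $r\ge 1$ be an integer, $\gamma>0$, and let $C_r>0$ be a constant depending only on $r$ (the choice is arbitrary). For $2\le i\le r$ put $$x_{r,i,\gamma}:=3^{\,r\frac{2+i\gamma}{i\gamma}}\,2^{-1/\gamma}\,C_r^{-1}.$$ Then there are constants $A_{r,\gamma}>0$ and $B_{r,\gamma}>0$, depending only on $r$ and $\gamma$ (once $C_r$ is fixed), such that the following holds. Let $(S,\mathcal S)$ be a measurable space, let $h\colon S^r\to\mathbb R$ be measurable for the product $\sigma$-algebra and symmetric, i.e. $h(s_{\sigma(1)},\dots,s_{\sigma(r)})=h(s_1,\dots,s_r)$ for all $s_1,\dots,s_r\in S$ and all permutations $\sigma$ of $\{1,\dots,r\}$, and let $(X_j)_{j\ge1}$ be an i.i.d. sequence of $S$-valued random variables on a probability space. Put $$U_n:=\sum_{1\le j_1<\dots<j_r\le n}h(X_{j_1},\dots,X_{j_r}).$$ Let $i\in\{2,\dots,r\}$ and assume that $h$ is degenerate of order $i-1$, i.e. $Y:=h(X_1,\dots,X_r)$ is integrable, $\mathbb E[Y\mid X_1,\dots,X_{i-1}]=0$ almost surely, and $\mathbb E[Y\mid X_1,\dots,X_i]$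 is not almost surely equal to $0$. Then for all $x\ge x_{r,i,\gamma}$ and all integers $N\ge r$, $$\mathbb P\Bigl\{\max_{r\le n\le N}|U_n|>N^{r-i/2}x\Bigr\}\le A_{r,\gamma}\exp\Bigl(-B_{r,\gamma}\,x^{\frac{2\gamma}{i\gamma+2}}\Bigr)\,\mathbb E\bigl[\exp\bigl(|h(X_1,\dots,X_r)|^{\gamma}\bigr)\bigr],$$ where the right-hand side is $+\infty$ if the expectation is infinite. -/

import Mathlib

open MeasureTheory ProbabilityTheory

/-- The `U`-statistic `∑_{1 ≤ i₁ < ⋯ < i_r ≤ n} h(X_{i₁}, …, X_{i_r})` of order `r`. The data sequence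
is indexed from `0`, so `X j` stands for `X_{j+1}` and the increasing indices run over `{0, …, n-1}`. -/
noncomputable def uStat {Ω S : Type*} {r : ℕ} (h : (Fin r → S) → ℝ) (X : ℕ → Ω → S)
    (n : ℕ) (ω : Ω) : ℝ :=
  open Classical in
  ∑ i : Fin r → Fin n with StrictMono i, h (fun k => X (i k) ω)

/-- `max_{r ≤ n ≤ N} |U_n|`. -/
noncomputable def maxAbsUStat {Ω S : Type*} {r : ℕ} (h : (Fin r → S) → ℝ) (X : ℕ → Ω → S)
    {N : ℕ} (hN : r ≤ N) (ω : Ω) : ℝ :=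
  (Finset.Icc r N).sup' (Finset.nonempty_Icc.2 hN) (fun n => |uStat h X n ω|)

/-- `h(X_1, …, X_r)`. -/
def firstValue {Ω S : Type*} {r : ℕ} (h : (Fin r → S) → ℝ) (X : ℕ → Ω → S) (ω : Ω) : ℝ :=
  h (fun k => X k ω)

/-- The kernel `h` is symmetric. -/
def IsSymmetricKernel {S : Type*} {r : ℕ} (h : (Fin r → S) → ℝ) : Prop :=
  ∀ (σ : Equiv.Perm (Fin r)) (s : Fin r → S), h (fun k => s (σ k)) = h s

/-- `X` is a sequence of independent, identically distributed random variables. -/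
structure IsIIDSeq {Ω S : Type*} [MeasurableSpace Ω] [MeasurableSpace S] (μ : Measure Ω)
    (X : ℕ → Ω → S) : Prop where
  measurable : ∀ j, Measurable (X j)
  indep : iIndepFun X μ
  identDistrib : ∀ j, IdentDistrib (X j) (X 0) μ μ

/-- The `σ`-algebra generated by the first `j` random variables `X_1, …, X_j`. -/
@[reducible]
def sigmaFirst {Ω S : Type*} [MeasurableSpace S] (X : ℕ → Ω → S) (j : ℕ) : MeasurableSpace Ω :=
  ⨆ k : Fin j, MeasurableSpace.comap (X k) inferInstance

/-- The `U`-statistic with kernel `h` is degenerate of order `d`: `Y = h(X_1, …, X_r)` is integrable,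
`E[Y | X_1, …, X_d] = 0` almost surely, and it is not true that `E[Y | X_1, …, X_{d+1}] = 0` almost
surely. -/
structure IsDegenerateOfOrder {Ω S : Type*} [MeasurableSpace Ω] [MeasurableSpace S]
    (μ : Measure Ω) (X : ℕ → Ω → S) {r : ℕ} (h : (Fin r → S) → ℝ) (d : ℕ) : Prop where
  integrable : Integrable (firstValue h X) μ
  condExp_eq_zero : μ[firstValue h X | sigmaFirst X d] =ᵐ[μ] 0
  condExp_succ_ne_zero : ¬ μ[firstValue h X | sigmaFirst X (d + 1)] =ᵐ[μ] 0

/-- The threshold `x_{r,i,γ} = 3^{r(2+iγ)/(iγ)} 2^{-1/γ} C_r⁻¹`, with `c` for `C_r`. -/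
noncomputable def xThreshold (c : ℝ) (r i : ℕ) (γ : ℝ) : ℝ :=
  (3 : ℝ) ^ ((r : ℝ) * ((2 + (i : ℝ) * γ) / ((i : ℝ) * γ))) * (2 : ℝ) ^ (-1 / γ) * c⁻¹

/-! The proof is a moment method with a moment order `2 * k` that grows with `x`.

The `2 * k`-th power of an increment `U_b - U_a` is a sum over families of `2 * k` increasing
tuples. If some tuple of a family shares fewer than `i` of its indices with the other tuples,
degeneracy makes the expectation of that product vanish (`IsIIDSeq.integral_prod_kernel_eq_zero`).
In a surviving family the repetitions leave at most `k * (2 * r - i)` distinct indices. Each tuple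
also has an entry at least `a`, so at most `k * (2 * r - i - 1)` of them lie below `a`. A weighted
count (`card_sharingFamilies_le`) then bounds the moment, for increments of length at most `d`, by
`(C * n ^ (2 * r - i - 1) * d * k ^ i) ^ k * E|h| ^ (2 * k)`, with `C` depending only on `r`.

This bound is of order `d ^ k` with `k ≥ 2`, so dyadic chaining controls the maximum over `n`
(`measureReal_exists_lt_abs_le`). The count needs `d ≥ 2 * k * r`; shorter blocks are handled by a
union bound, and smaller `N` by counting all tuples.

The exponential moment of `|h| ^ γ` bounds `E|h| ^ (2 * k)` by `(2 * k / γ) ^ (2 * k / γ)` times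
itself. The tail is thus about `(D * k ^ (i + 2 / γ) / x ^ 2) ^ k`, and `k` of order `x ^ (2 * γ /
(i * γ + 2))` makes the base a constant below one. -/

/-! ### Weighted counting of functions by their set of values. -/

/-- Values are added one at a time: a new value contributes its weight, and a repeated one leaves
the product unchanged and has at most `L` choices. Each step costs a factor of at most `∑ y, w y +
M`; keeping `M` apart from `L` makes this factor the same in all steps. -/
theorem Fintype.sum_prod_image_le_fin {α : Type*} [Fintype α] [DecidableEq α] (w : α → ℝ)
    (hw : ∀ y, 0 ≤ w y) (L : ℕ) (M : ℝ) (hM : (L : ℝ) ≤ M) :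
    ∑ g : Fin L → α, ∏ y ∈ Finset.univ.image g, w y ≤ (∑ y, w y + M) ^ L := by
  have hW : 0 ≤ ∑ y, w y := Finset.sum_nonneg fun y _ => hw y
  induction L with
  | zero => simp
  | succ L ih =>
    push_cast at hM
    have hM0 : 0 ≤ M := le_trans (by positivity) hM
    rw [← (Fin.consEquiv fun _ : Fin (L + 1) => α).sum_comp, Fintype.sum_prod_type_right]
    have hstep : ∀ g : Fin L → α,
        ∑ y, ∏ z ∈ Finset.univ.image (Fin.consEquiv (fun _ : Fin (L + 1) => α) (y, g)), w z
          ≤ (∏ z ∈ Finset.univ.image g, w z) * (∑ y, w y + M) := by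
      intro g
      have himg : ∀ y, Finset.univ.image (Fin.consEquiv (fun _ : Fin (L + 1) => α) (y, g))
          = insert y (Finset.univ.image g) := by
        intro y
        ext z
        simp [Fin.consEquiv, Fin.exists_fin_succ, eq_comm]
      have hP : 0 ≤ ∏ z ∈ Finset.univ.image g, w z := Finset.prod_nonneg fun z _ => hw z
      calc _ ≤ ∑ y, ((∏ z ∈ Finset.univ.image g, w z) * w y +
            if y ∈ Finset.univ.image g then ∏ z ∈ Finset.univ.image g, w z else 0) := by
            refine Finset.sum_le_sum fun y _ => ?_
            rw [himg]
            split_ifs with hy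
            · rw [Finset.insert_eq_of_mem hy]
              nlinarith [mul_nonneg hP (hw y)]
            · rw [Finset.prod_insert hy, mul_comm]; simp
        _ ≤ _ := by
            rw [Finset.sum_add_distrib, ← Finset.mul_sum, mul_add]
            gcongr
            rw [← Finset.sum_filter, Finset.sum_const, nsmul_eq_mul, mul_comm]
            gcongr
            have h1 : (Finset.univ.filter fun y => y ∈ Finset.univ.image g).card ≤ L := by
              rw [Finset.filter_univ_mem]
              exact Finset.card_image_le.trans (by simp)
            have h2 : (((Finset.univ.filter fun y => y ∈ Finset.univ.image g).card : ℕ) : ℝ) ≤ L := by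
              exact_mod_cast h1
            linarith
    calc _ ≤ ∑ g : Fin L → α, (∏ z ∈ Finset.univ.image g, w z) * (∑ y, w y + M) :=
          Finset.sum_le_sum fun g _ => hstep g
      _ = (∑ g : Fin L → α, ∏ z ∈ Finset.univ.image g, w z) * (∑ y, w y + M) := by
          rw [Finset.sum_mul]
      _ ≤ (∑ y, w y + M) ^ L * (∑ y, w y + M) := by
          gcongr
          exact ih (by linarith)
      _ = _ := (pow_succ _ _).symm

/-- Summing the product of the weights of the distinct values over all functions `P → α`. -/
theorem Fintype.sum_prod_image_le {P α : Type*} [Fintype P] [DecidableEq P] [Fintype α]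
    [DecidableEq α] (w : α → ℝ) (hw : ∀ y, 0 ≤ w y) :
    ∑ g : P → α, ∏ y ∈ Finset.univ.image g, w y ≤
      (∑ y, w y + Fintype.card P) ^ Fintype.card P := by
  refine le_trans (le_of_eq ?_) (Fintype.sum_prod_image_le_fin w hw (Fintype.card P) _ le_rfl)
  refine Fintype.sum_equiv ((Fintype.equivFin P).arrowCongr (Equiv.refl α)) _ _ fun g => ?_
  congr 1
  ext z
  simp only [Finset.mem_image, Finset.mem_univ, true_and]
  constructor
  · rintro ⟨a, rfl⟩
    exact ⟨Fintype.equivFin P a, by simp [Equiv.arrowCongr]⟩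
  · rintro ⟨a, rfl⟩
    exact ⟨(Fintype.equivFin P).symm a, by simp [Equiv.arrowCongr]⟩

/-! ### Families of tuples and the number of indices they use. -/

/-- The strictly increasing `r`-tuples with values in `{0, …, n-1}`. -/
def strictTuples (r n : ℕ) : Finset (Fin r → ℕ) :=
  open Classical in (Fintype.piFinset fun _ => Finset.range n).filter StrictMono

theorem mem_strictTuples {r n : ℕ} {J : Fin r → ℕ} :
    J ∈ strictTuples r n ↔ (∀ k, J k < n) ∧ StrictMono J := by
  simp [strictTuples]

theorem strictTuples_mono (r : ℕ) {a b : ℕ} (hab : a ≤ b) : strictTuples r a ⊆ strictTuples r b := by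
  intro J hJ
  rw [mem_strictTuples] at hJ ⊢
  exact ⟨fun k => (hJ.1 k).trans_le hab, hJ.2⟩

/-- The indices that occur in a member of the family `f` other than the `a`-th. -/
def otherIndices {p r : ℕ} (f : Fin p → Fin r → ℕ) (a : Fin p) : Finset ℕ :=
  (Finset.univ.erase a).biUnion fun b => Finset.univ.image (f b)

/-- The positions of the `a`-th tuple whose index occurs in another member of the family. -/
def sharedPositions {p r : ℕ} (f : Fin p → Fin r → ℕ) (a : Fin p) : Finset (Fin r) :=
  Finset.univ.filter fun k => f a k ∈ otherIndices f a

theorem mem_otherIndices {p r : ℕ} {f : Fin p → Fin r → ℕ} {a : Fin p} {j : ℕ} :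
    j ∈ otherIndices f a ↔ ∃ b, b ≠ a ∧ ∃ k, f b k = j := by
  simp [otherIndices]

/-- Twice the number of the distinct indices is at most the number of the positions holding them,
when positions that are not shared count twice. -/
theorem two_mul_card_image_le {p r : ℕ} (f : Fin p → Fin r → ℕ)
    (R : Finset (Fin p × Fin r)) (hR : ∀ x ∈ R, ∀ y, f y.1 y.2 = f x.1 x.2 → y ∈ R) :
    2 * (R.image fun x => f x.1 x.2).card ≤
      ∑ x ∈ R, if x.2 ∈ sharedPositions f x.1 then 1 else 2 := by
  classical
  rw [mul_comm, ← smul_eq_mul, ← Finset.sum_const,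
    ← Finset.sum_fiberwise_of_maps_to (g := fun x : Fin p × Fin r => f x.1 x.2)
      (t := R.image fun x => f x.1 x.2) fun x hx => Finset.mem_image_of_mem _ hx]
  refine Finset.sum_le_sum fun j hj => ?_
  obtain ⟨x, hx, rfl⟩ := Finset.mem_image.1 hj
  -- A shared index is held by positions in two different tuples, both in `R` by `hR`, each of
  -- weight at least one. An unshared position has weight two by itself.
  by_cases hs : x.2 ∈ sharedPositions f x.1
  · have hs' := hs
    simp only [sharedPositions, Finset.mem_filter, Finset.mem_univ, true_and, mem_otherIndices] at hs'
    obtain ⟨b, hb, l, hl⟩ := hs'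
    have hne : x ≠ (b, l) := fun h => hb (by rw [h])
    have hsub : ({x, (b, l)} : Finset _) ⊆ R.filter fun y => f y.1 y.2 = f x.1 x.2 := by
      intro y hy
      rw [Finset.mem_insert, Finset.mem_singleton] at hy
      rcases hy with rfl | rfl
      · simp [hx]
      · simp [hl, hR x hx (b, l) hl]
    refine le_trans ?_ (Finset.sum_le_sum_of_subset hsub)
    rw [Finset.sum_pair hne]
    split_ifs <;> omega
  · refine le_trans ?_ (Finset.single_le_sum (fun _ _ => Nat.zero_le _)
      (Finset.mem_filter.2 ⟨hx, rfl⟩ : x ∈ R.filter fun y => f y.1 y.2 = f x.1 x.2))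
    simp [hs]

theorem sum_sharing_weight_eq {p r : ℕ} (f : Fin p → Fin r → ℕ) (a : Fin p) :
    (∑ k : Fin r, if k ∈ sharedPositions f a then 1 else 2) + (sharedPositions f a).card = 2 * r := by
  classical
  have h : (sharedPositions f a).card = ∑ k : Fin r, if k ∈ sharedPositions f a then 1 else 0 := by
    simp
  rw [h, ← Finset.sum_add_distrib]
  have : ∀ k : Fin r, ((if k ∈ sharedPositions f a then 1 else 2) +
      if k ∈ sharedPositions f a then 1 else 0) = 2 := fun k => by split_ifs <;> rfl
  simp [this, mul_comm]

/-- The total weight of one tuple is `2 * r` minus the number of its shared positions, hence at most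
`2 * r - i`. -/
theorem two_mul_card_indices_add_le {p r i : ℕ} (f : Fin p → Fin r → ℕ)
    (hf : ∀ a, i ≤ (sharedPositions f a).card) :
    2 * (Finset.univ.image fun x : Fin p × Fin r => f x.1 x.2).card + p * i ≤ p * (2 * r) := by
  have h := two_mul_card_image_le f Finset.univ (by simp)
  rw [Fintype.sum_prod_type] at h
  have h2 : (∑ a : Fin p, ∑ k : Fin r, if k ∈ sharedPositions f a then 1 else 2) + p * i
      ≤ p * (2 * r) := by
    calc _ = ∑ a : Fin p, ((∑ k : Fin r, if k ∈ sharedPositions f a then 1 else 2) + i) := by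
          simp [Finset.sum_add_distrib]
      _ ≤ ∑ a : Fin p, 2 * r := by
          refine Finset.sum_le_sum fun a _ => ?_
          rw [← sum_sharing_weight_eq f a]
          exact Nat.add_le_add_left (hf a) _
      _ = _ := by simp
  exact le_trans (Nat.add_le_add_right h _) h2

/-- Among the positions below `m` every tuple lacks at least one, of weight at least one, so `i`
improves to `i + 1`. This gain is the source of the factor `d` in the moment bound for increments.
-/
theorem two_mul_card_low_indices_add_le {p r i m : ℕ} (f : Fin p → Fin r → ℕ)
    (hf : ∀ a, i ≤ (sharedPositions f a).card) (hm : ∀ a, ∃ k, m ≤ f a k) :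
    2 * ((Finset.univ.image fun x : Fin p × Fin r => f x.1 x.2).filter (· < m)).card + p * (i + 1)
      ≤ p * (2 * r) := by
  classical
  have h := two_mul_card_image_le f (Finset.univ.filter fun x => f x.1 x.2 < m) (by
    intro x hx y hy; simp only [Finset.mem_filter, Finset.mem_univ, true_and] at hx ⊢; rwa [hy])
  rw [Finset.filter_image]
  refine le_trans (Nat.add_le_add_right h _) ?_
  rw [Finset.sum_filter, Fintype.sum_prod_type]
  calc _ = ∑ a : Fin p, ((∑ k : Fin r, if f a k < m then
            if k ∈ sharedPositions f a then 1 else 2 else 0) + (i + 1)) := by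
          simp [Finset.sum_add_distrib]
      _ ≤ ∑ a : Fin p, 2 * r := by
          refine Finset.sum_le_sum fun a _ => ?_
          rw [← sum_sharing_weight_eq f a]
          have h1 : (∑ k : Fin r, if f a k < m then
            if k ∈ sharedPositions f a then 1 else 2 else 0) <
              ∑ k : Fin r, if k ∈ sharedPositions f a then 1 else 2 := by
            obtain ⟨k, hk⟩ := hm a
            refine Finset.sum_lt_sum (fun k _ => by split_ifs <;> omega) ⟨k, Finset.mem_univ _, ?_⟩
            rw [if_neg (not_lt.2 hk)]
            split_ifs <;> omega
          have := hf a
          omega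
      _ = _ := by simp

/-- The families of `p` tuples from `strictTuples r b \ strictTuples r a` in which every tuple has at
least `i` shared positions. -/
def sharingFamilies (p r i a b : ℕ) : Finset (Fin p → Fin r → ℕ) :=
  (Fintype.piFinset fun _ => strictTuples r b \ strictTuples r a).filter
    fun f => ∀ c, i ≤ (sharedPositions f c).card

/-- An exponential-weight (Rankin-type) bound: indices below `a` get weight `q / n` and the others
`q / d`, so that the total weight is at most `2 * q`, comparable with the number `q` of positions. A
constant `K` lifts the weight of each sharing family to at least one, and the weighted sum over all
functions is at most `(3 * q) ^ (2 * k * r)`. -/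
theorem card_sharingFamilies_le {r i a b n d k : ℕ} (hir : i + 1 ≤ 2 * r)
    (hab : a ≤ b) (hbn : b ≤ n) (hd : b - a ≤ d) (hdn : d ≤ n) (hk : 0 < k) (hr : 0 < r)
    (hq : 2 * k * r ≤ d) :
    ((sharingFamilies (2 * k) r i a b).card : ℝ) ≤
      (9 ^ r * (n : ℝ) ^ (2 * r - i - 1) * d * (2 * k * r : ℝ) ^ i) ^ k := by
  classical
  set q : ℝ := 2 * k * r with hqdef
  have hk' : (0 : ℝ) < k := by exact_mod_cast hk
  have hr' : (0 : ℝ) < r := by exact_mod_cast hr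
  have hq0 : 0 < q := by positivity
  have hqd : q ≤ d := by rw [hqdef]; exact_mod_cast hq
  have hdn' : (d : ℝ) ≤ n := by exact_mod_cast hdn
  have hd0 : (0 : ℝ) < d := hq0.trans_le hqd
  have hn0 : (0 : ℝ) < n := hd0.trans_le hdn'
  set w : ℕ → ℝ := fun y => if y < a then q / n else q / d with hw
  have hw0 : ∀ y, 0 ≤ w y := fun y => by rw [hw]; dsimp only; split_ifs <;> positivity
  obtain ⟨e, he⟩ : ∃ e, 2 * r = e + i + 1 := ⟨2 * r - i - 1, by omega⟩
  have he' : 2 * r - i - 1 = e := by omega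
  rw [he']
  -- With `v₁` distinct indices below `a` and `v₂` above, the family has weight `(q / n) ^ v₁ * (q /
  -- d) ^ v₂`. Since `v₁ ≤ k * e`, `v₁ + v₂ ≤ k * (e + 1)` and `q ≤ d ≤ n`, the extremal exponents
  -- give the constant.
  have hone : ∀ f ∈ sharingFamilies (2 * k) r i a b,
      1 ≤ ((n / d : ℝ) ^ (k * e) * (d / q) ^ (k * (e + 1))) *
        ∏ y ∈ Finset.univ.image (fun x : Fin (2 * k) × Fin r => f x.1 x.2), w y := by
    intro f hf
    rw [sharingFamilies, Finset.mem_filter, Fintype.mem_piFinset] at hf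
    obtain ⟨hmem, hsh⟩ := hf
    have hlow : ∀ c, ∃ l, a ≤ f c l := by
      intro c
      have := hmem c
      rw [Finset.mem_sdiff, mem_strictTuples, mem_strictTuples] at this
      by_contra! hcon
      exact this.2 ⟨hcon, this.1.2⟩
    have h1 := two_mul_card_indices_add_le f hsh
    have h2 := two_mul_card_low_indices_add_le f hsh hlow
    set I := Finset.univ.image (fun x : Fin (2 * k) × Fin r => f x.1 x.2)
    have h3 : (I.filter (· < a)).card + (I.filter fun y => ¬ y < a).card = I.card :=
      Finset.card_filter_add_card_filter_not _
    set v₁ := (I.filter (· < a)).card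
    set v₂ := (I.filter fun y => ¬ y < a).card
    have h4 : v₁ ≤ k * e := by rw [he] at h2; nlinarith
    have h5 : v₁ + v₂ ≤ k * (e + 1) := by rw [h3]; rw [he] at h1; nlinarith
    obtain ⟨s, hs⟩ := Nat.exists_eq_add_of_le h4
    obtain ⟨t, ht⟩ := Nat.exists_eq_add_of_le h5
    have hprod : ∏ y ∈ I, w y = (q / n) ^ v₁ * (q / d) ^ v₂ := by
      rw [hw, Finset.prod_ite, Finset.prod_const, Finset.prod_const]
    rw [hprod, hs, ht]
    have hnd : 1 ≤ (n / d : ℝ) := (one_le_div hd0).2 hdn'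
    have hdq : 1 ≤ (d / q : ℝ) := (one_le_div hq0).2 hqd
    have : (n / d : ℝ) ^ (v₁ + s) * (d / q) ^ (v₁ + v₂ + t) * ((q / n) ^ v₁ * (q / d) ^ v₂)
        = (n / d : ℝ) ^ s * (d / q) ^ t := by
      simp only [pow_add, div_pow]
      field_simp
    rw [this]
    exact one_le_mul_of_one_le_of_one_le (one_le_pow₀ hnd) (one_le_pow₀ hdq)
  set K : ℝ := (n / d : ℝ) ^ (k * e) * (d / q) ^ (k * (e + 1))
  have hK : 0 ≤ K := by positivity
  let ψ : (Fin (2 * k) × Fin r → Fin b) → (Fin (2 * k) → Fin r → ℕ) := fun g c l => (g (c, l) : ℕ)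
  have hψ : Function.Injective ψ := by
    intro g g' hgg
    funext x
    exact Fin.ext (congrFun (congrFun hgg x.1) x.2)
  have hsub : sharingFamilies (2 * k) r i a b ⊆ Finset.univ.image ψ := by
    intro f hf
    rw [sharingFamilies, Finset.mem_filter, Fintype.mem_piFinset] at hf
    refine Finset.mem_image.2 ⟨fun x => ⟨f x.1 x.2, ?_⟩, Finset.mem_univ _, rfl⟩
    exact (mem_strictTuples.1 (Finset.mem_sdiff.1 (hf.1 x.1)).1).1 x.2
  have hsumw : ∑ y : Fin b, w y ≤ 2 * q := by
    rw [Fin.sum_univ_eq_sum_range w b, ← Finset.sum_range_add_sum_Ico _ hab]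
    have e1 : ∑ y ∈ Finset.range a, w y ≤ q := by
      rw [Finset.sum_congr rfl fun y hy => if_pos (Finset.mem_range.1 hy)]
      have : (a : ℝ) ≤ n := by exact_mod_cast hab.trans hbn
      rw [Finset.sum_const, Finset.card_range, nsmul_eq_mul, mul_div_assoc', div_le_iff₀ hn0]
      nlinarith
    have e2 : ∑ y ∈ Finset.Ico a b, w y ≤ q := by
      rw [Finset.sum_congr rfl fun y hy => if_neg (not_lt.2 (Finset.mem_Ico.1 hy).1)]
      have : ((b - a : ℕ) : ℝ) ≤ d := by exact_mod_cast hd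
      rw [Finset.sum_const, Nat.card_Ico, nsmul_eq_mul, mul_div_assoc', div_le_iff₀ hd0]
      nlinarith
    linarith
  calc ((sharingFamilies (2 * k) r i a b).card : ℝ)
      = ∑ f ∈ sharingFamilies (2 * k) r i a b, 1 := by simp
    _ ≤ ∑ f ∈ sharingFamilies (2 * k) r i a b, K *
        ∏ y ∈ Finset.univ.image (fun x : Fin (2 * k) × Fin r => f x.1 x.2), w y :=
        Finset.sum_le_sum hone
    _ ≤ ∑ f ∈ Finset.univ.image ψ, K *
        ∏ y ∈ Finset.univ.image (fun x : Fin (2 * k) × Fin r => f x.1 x.2), w y :=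
        Finset.sum_le_sum_of_subset_of_nonneg hsub fun f _ _ =>
          mul_nonneg hK (Finset.prod_nonneg fun y _ => hw0 y)
    _ = K * ∑ g : Fin (2 * k) × Fin r → Fin b, ∏ y ∈ Finset.univ.image g, w y := by
        rw [Finset.sum_image fun _ _ _ _ h => hψ h, Finset.mul_sum]
        refine Finset.sum_congr rfl fun g _ => ?_
        congr 1
        rw [← Finset.prod_image (s := Finset.univ.image g) (f := w) (g := fun y : Fin b => (y : ℕ))
          (fun _ _ _ _ h => Fin.ext h), Finset.image_image]
        rfl
    _ ≤ K * (3 * q) ^ (2 * k * r) := by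
        gcongr
        refine (Fintype.sum_prod_image_le (fun y : Fin b => w y) fun y => hw0 y).trans ?_
        have hc : Fintype.card (Fin (2 * k) × Fin r) = 2 * k * r := by simp
        rw [hc]
        refine pow_le_pow_left₀ (add_nonneg (Finset.sum_nonneg fun y _ => hw0 _)
          (Nat.cast_nonneg _)) ?_ _
        push_cast
        linarith
    _ = _ := by
        have h6 : 2 * k * r = k * (e + 1) + k * i := by rw [mul_comm 2 k, mul_assoc, he]; ring
        have h7 : (3 * q) ^ (2 * k * r) = (9 ^ r) ^ k * (q ^ (k * (e + 1)) * q ^ (k * i)) := by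
          have h8 : (9 : ℝ) = 3 ^ 2 := by norm_num
          rw [mul_pow, ← pow_add, ← h6, h8, ← pow_mul, ← pow_mul]
          congr 2
          ring
        rw [h7]
        simp only [K, div_pow, mul_pow, ← pow_mul]
        rw [mul_comm e k, mul_comm i k, mul_add k e 1, pow_add, pow_add, mul_one]
        field_simp

/-! ### Orthogonality from degeneracy. -/

theorem Finset.exists_perm_val_lt {r e : ℕ} (K : Finset (Fin r)) (hK : K.card ≤ e) :
    ∃ σ : Equiv.Perm (Fin r), ∀ k ∈ K, (σ k : ℕ) < e := by
  classical
  have hKr : K.card ≤ r := by simpa using Finset.card_le_univ K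
  have hcard : Fintype.card {k : Fin r // k ∈ K} = Fintype.card {k : Fin r // (k : ℕ) < K.card} := by
    rw [Fintype.card_coe, Fintype.card_subtype, Fin.card_filter_val_lt, min_eq_right hKr]
  let τ : {k : Fin r // k ∈ K} ≃ {k : Fin r // (k : ℕ) < K.card} := Fintype.equivOfCardEq hcard
  exact ⟨τ.extendSubtype, fun k hk => (τ.extendSubtype_mem k hk).trans_le hK⟩

theorem IsIIDSeq.measurable_tuple {Ω S : Type*} [MeasurableSpace Ω]
    [MeasurableSpace S] {μ : Measure Ω} {X : ℕ → Ω → S} (hX : IsIIDSeq μ X) {ι : Type*} (J : ι → ℕ) :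
    Measurable fun ω (k : ι) => X (J k) ω :=
  measurable_pi_lambda _ fun k => hX.measurable (J k)

/-- A vector of length `r` put together from its coordinates in `K` and in the complement of `K`. -/
def glueTuple {r : ℕ} {S : Type*} (K : Finset (Fin r)) (z : K → S) (v : (Kᶜ : Finset (Fin r)) → S)
    (k : Fin r) : S :=
  if hk : k ∈ K then z ⟨k, hk⟩ else v ⟨k, Finset.mem_compl.2 hk⟩

theorem measurable_glueTuple {r : ℕ} {S : Type*} [MeasurableSpace S] (K : Finset (Fin r)) :
    Measurable fun x : (K → S) × ((Kᶜ : Finset (Fin r)) → S) => glueTuple K x.1 x.2 := by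
  refine measurable_pi_lambda _ fun k => ?_
  unfold glueTuple
  split_ifs
  · exact (measurable_pi_apply _).comp measurable_fst
  · exact (measurable_pi_apply _).comp measurable_snd

theorem glueTuple_restrict {r : ℕ} {S : Type*} (K : Finset (Fin r)) (z : Fin r → S) :
    glueTuple K (fun k => z k) (fun k => z k) = z := by
  funext k
  unfold glueTuple
  split_ifs <;> rfl

section Vanishing

variable {Ω S : Type*} [MeasurableSpace Ω] [MeasurableSpace S] {μ : Measure Ω}
  [IsProbabilityMeasure μ] {X : ℕ → Ω → S} {r : ℕ} {h : (Fin r → S) → ℝ}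

theorem IsIIDSeq.map_tuple (hX : IsIIDSeq μ X) {J : Fin r → ℕ} (hJ : J.Injective) :
    μ.map (fun ω k => X (J k) ω) = Measure.pi fun _ => μ.map (X 0) := by
  rw [(iIndepFun_iff_map_fun_eq_pi_map fun k => (hX.measurable (J k)).aemeasurable).1
    (hX.indep.precomp hJ)]
  congr 1
  funext k
  exact (hX.identDistrib (J k)).map_eq

theorem IsIIDSeq.identDistrib_tuple (hX : IsIIDSeq μ X) {J J' : Fin r → ℕ} (hJ : J.Injective)
    (hJ' : J'.Injective) :
    IdentDistrib (fun ω k => X (J k) ω) (fun ω k => X (J' k) ω) μ μ where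
  aemeasurable_fst := (hX.measurable_tuple J).aemeasurable
  aemeasurable_snd := (hX.measurable_tuple J').aemeasurable
  map_eq := by rw [hX.map_tuple hJ, hX.map_tuple hJ']

theorem IsIIDSeq.identDistrib_kernel (hX : IsIIDSeq μ X) (hh : Measurable h) {J : Fin r → ℕ}
    (hJ : J.Injective) : IdentDistrib (fun ω => h fun k => X (J k) ω) (firstValue h X) μ μ :=
  (hX.identDistrib_tuple hJ (J' := fun k => (k : ℕ)) Fin.val_injective).comp hh

/-- If `h(X_1, …, X_r)` is centered given `X_1, …, X_e`, then `h(X_J)` is centered given any `e`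
of its arguments. -/
theorem IsIIDSeq.integral_kernel_mul_indicator_eq_zero (hX : IsIIDSeq μ X) (hh : Measurable h)
    (hsymm : IsSymmetricKernel h) {e : ℕ}
    (hdeg : ∀ s, MeasurableSet[sigmaFirst X e] s → ∫ ω in s, firstValue h X ω ∂μ = 0)
    {J : Fin r → ℕ} (hJ : J.Injective) {K : Finset (Fin r)} (hK : K.card ≤ e)
    {A : Set (K → S)} (hA : MeasurableSet A) :
    ∫ ω, A.indicator 1 (fun k : K => X (J k) ω) * h (fun k => X (J k) ω) ∂μ = 0 := by
  obtain ⟨σ, hσ⟩ := K.exists_perm_val_lt hK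
  have hinj : Function.Injective fun k : Fin r => (σ k : ℕ) := Fin.val_injective.comp σ.injective
  let F : (Fin r → S) → ℝ := fun z => A.indicator 1 (fun k : K => z k) * h z
  have hF : Measurable F := by
    refine Measurable.mul (Measurable.comp (measurable_one.indicator hA) ?_) hh
    exact measurable_pi_lambda _ fun k => measurable_pi_apply _
  -- Replacing the indices `J` by `σ` keeps the law and moves the arguments in `K` among the first
  -- `e` variables; symmetry then turns the kernel back into `firstValue h X`.
  have h1 := ((hX.identDistrib_tuple hJ hinj).comp hF).integral_eq
  refine h1.trans ?_
  have hle : sigmaFirst X e ≤ ‹MeasurableSpace Ω› :=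
    iSup_le fun k => (hX.measurable k).comap_le
  set s : Set Ω := (fun ω (k : K) => X (σ k) ω) ⁻¹' A with hs
  have hsm : MeasurableSet[sigmaFirst X e] s := by
    refine (?_ : Measurable[sigmaFirst X e] fun ω (k : K) => X (σ k) ω) hA
    refine @measurable_pi_lambda _ _ _ (sigmaFirst X e) _ _ fun k => ?_
    exact (comap_measurable (X (σ k))).mono
      (le_iSup (fun j : Fin e => MeasurableSpace.comap (X j) inferInstance) ⟨σ k, hσ k k.2⟩) le_rfl
  rw [← hdeg s hsm, ← integral_indicator (hle _ hsm)]
  refine integral_congr_ae (Filter.Eventually.of_forall fun ω => ?_)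
  have h2 : h (fun k => X (σ k) ω) = firstValue h X ω := hsymm σ fun k => X k ω
  simp only [F, Function.comp_apply, h2]
  by_cases hω : ω ∈ s
  · rw [Set.indicator_of_mem hω, Set.indicator_of_mem (show (fun k : K => X (σ k) ω) ∈ A from hω)]
    simp
  · rw [Set.indicator_of_notMem hω,
      Set.indicator_of_notMem (show (fun k : K => X (σ k) ω) ∉ A from hω), zero_mul]

/-- The Fubini form of the vanishing conditional expectation: the partial integral has integral zero
over every measurable set of values of the coordinates in `K`, hence is zero almost everywhere. -/
theorem IsIIDSeq.ae_integral_glueTuple_eq_zero (hX : IsIIDSeq μ X) (hh : Measurable h)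
    (hsymm : IsSymmetricKernel h) (hint : Integrable (firstValue h X) μ) {e : ℕ}
    (hdeg : ∀ s, MeasurableSet[sigmaFirst X e] s → ∫ ω in s, firstValue h X ω ∂μ = 0)
    {J : Fin r → ℕ} (hJ : J.Injective) {K : Finset (Fin r)} (hK : K.card ≤ e) :
    ∀ᵐ z ∂(μ.map fun ω (k : K) => X (J k) ω),
      ∫ v, h (glueTuple K z v) ∂(μ.map fun ω (k : (Kᶜ : Finset (Fin r))) => X (J k) ω) = 0 := by
  set U := fun ω (k : K) => X (J k) ω
  set V := fun ω (k : (Kᶜ : Finset (Fin r))) => X (J k) ω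
  have hU : Measurable U := hX.measurable_tuple fun k : K => J k
  have hV : Measurable V := hX.measurable_tuple fun k : (Kᶜ : Finset (Fin r)) => J k
  have hUV : IndepFun U V μ :=
    (hX.indep.precomp hJ).indepFun_finset K Kᶜ disjoint_compl_right fun k => hX.measurable (J k)
  have hprod := (indepFun_iff_map_prod_eq_prod_map_map hU.aemeasurable hV.aemeasurable).1 hUV
  have hF : Measurable fun x : (K → S) × ((Kᶜ : Finset (Fin r)) → S) => h (glueTuple K x.1 x.2) :=
    hh.comp (measurable_glueTuple K)
  have hFX : ∀ ω, h (glueTuple K (U ω) (V ω)) = h fun k => X (J k) ω := fun ω =>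
    congrArg h (glueTuple_restrict K fun k => X (J k) ω)
  have : IsProbabilityMeasure (μ.map U) := Measure.isProbabilityMeasure_map hU.aemeasurable
  have : IsProbabilityMeasure (μ.map V) := Measure.isProbabilityMeasure_map hV.aemeasurable
  have hFint : Integrable (fun x : (K → S) × ((Kᶜ : Finset (Fin r)) → S) =>
      h (glueTuple K x.1 x.2)) ((μ.map U).prod (μ.map V)) := by
    rw [← hprod, integrable_map_measure hF.aestronglyMeasurable (hU.prodMk hV).aemeasurable]
    refine ((hX.identDistrib_kernel hh hJ).integrable_iff.2 hint).congr ?_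
    exact Filter.Eventually.of_forall fun ω => (hFX ω).symm
  refine hFint.integral_prod_left.ae_eq_zero_of_forall_setIntegral_eq_zero fun A hA _ => ?_
  rw [← hX.integral_kernel_mul_indicator_eq_zero hh hsymm hdeg hJ hK hA, ← integral_indicator hA]
  have hI : Integrable (fun x : (K → S) × ((Kᶜ : Finset (Fin r)) → S) =>
      A.indicator 1 x.1 * h (glueTuple K x.1 x.2)) ((μ.map U).prod (μ.map V)) := by
    refine hFint.mono (((measurable_one.indicator hA).comp measurable_fst).mul
      hF).aestronglyMeasurable (Filter.Eventually.of_forall fun x => ?_)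
    rw [norm_mul]
    refine mul_le_of_le_one_left (norm_nonneg _) ?_
    by_cases hx : x.1 ∈ A <;> simp [hx]
  calc _ = ∫ z, ∫ v, A.indicator 1 z * h (glueTuple K z v) ∂(μ.map V) ∂(μ.map U) := by
        refine integral_congr_ae (Filter.Eventually.of_forall fun z => ?_)
        dsimp only
        rw [integral_const_mul]
        by_cases hz : z ∈ A <;> simp [hz]
    _ = _ := by
        rw [← integral_prod _ hI, ← hprod, integral_map (hU.prodMk hV).aemeasurable
          (by rw [hprod]; exact hI.aestronglyMeasurable)]
        refine integral_congr_ae (Filter.Eventually.of_forall fun ω => ?_)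
        dsimp only
        rw [hFX ω]

/-- `h(X_J)` is orthogonal to the functions of `X_j`, `j ∈ O`, when few indices of `J` lie in `O`. -/
theorem IsIIDSeq.integral_kernel_mul_eq_zero (hX : IsIIDSeq μ X) (hh : Measurable h)
    (hsymm : IsSymmetricKernel h) (hint : Integrable (firstValue h X) μ) {e : ℕ}
    (hdeg : ∀ s, MeasurableSet[sigmaFirst X e] s → ∫ ω in s, firstValue h X ω ∂μ = 0)
    {J : Fin r → ℕ} (hJ : J.Injective) (O : Finset ℕ)
    (hO : (Finset.univ.filter fun k => J k ∈ O).card ≤ e) {g : (O → S) → ℝ} (hg : Measurable g)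
    (hgint : Integrable (fun ω => g (fun j : O => X j ω) * h fun k => X (J k) ω) μ) :
    ∫ ω, g (fun j : O => X j ω) * h (fun k => X (J k) ω) ∂μ = 0 := by
  set K := Finset.univ.filter fun k => J k ∈ O with hKdef
  have hKO : ∀ k : K, J k ∈ O := fun k => (Finset.mem_filter.1 k.2).2
  have hae := hX.ae_integral_glueTuple_eq_zero hh hsymm hint hdeg hJ hO
  set V := fun ω (k : (Kᶜ : Finset (Fin r))) => X (J k) ω
  set W := fun ω (j : O) => X j ω
  have hV : Measurable V := hX.measurable_tuple fun k : (Kᶜ : Finset (Fin r)) => J k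
  have hW : Measurable W := hX.measurable_tuple fun j : O => (j : ℕ)
  let ρ : (O → S) → K → S := fun x k => x ⟨J k, hKO k⟩
  have hρ : Measurable ρ := measurable_pi_lambda _ fun k => measurable_pi_apply _
  -- The arguments of `h` with index in `O` are the function `ρ` of `W`; the rest, `V`, uses indices
  -- outside `O`. So `V` can be integrated out with `W` fixed.
  have hWV : IndepFun W V μ := by
    have hdisj : Disjoint O (Kᶜ.image J) := by
      rw [Finset.disjoint_right]
      intro j hj hjO
      obtain ⟨k, hk, rfl⟩ := Finset.mem_image.1 hj
      exact Finset.mem_compl.1 hk (Finset.mem_filter.2 ⟨Finset.mem_univ _, hjO⟩)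
    have := hX.indep.indepFun_finset O (Kᶜ.image J) hdisj hX.measurable
    exact this.comp measurable_id (ψ := fun y (k : (Kᶜ : Finset (Fin r))) =>
      y ⟨J k, Finset.mem_image_of_mem J k.2⟩) (measurable_pi_lambda _ fun k => measurable_pi_apply _)
  have hprod := (indepFun_iff_map_prod_eq_prod_map_map hW.aemeasurable hV.aemeasurable).1 hWV
  have hF : Measurable fun x : (O → S) × ((Kᶜ : Finset (Fin r)) → S) =>
      g x.1 * h (glueTuple K (ρ x.1) x.2) :=
    (hg.comp measurable_fst).mul (hh.comp ((measurable_glueTuple K).comp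
      ((hρ.comp measurable_fst).prodMk measurable_snd)))
  have hFX : ∀ ω, g (W ω) * h (glueTuple K (ρ (W ω)) (V ω)) = g (W ω) * h fun k => X (J k) ω :=
    fun ω => congrArg (fun z => g (W ω) * h z) (glueTuple_restrict K fun k => X (J k) ω)
  have : IsProbabilityMeasure (μ.map W) := Measure.isProbabilityMeasure_map hW.aemeasurable
  have : IsProbabilityMeasure (μ.map V) := Measure.isProbabilityMeasure_map hV.aemeasurable
  have hI : Integrable (fun x : (O → S) × ((Kᶜ : Finset (Fin r)) → S) =>
      g x.1 * h (glueTuple K (ρ x.1) x.2)) ((μ.map W).prod (μ.map V)) := by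
    rw [← hprod, integrable_map_measure hF.aestronglyMeasurable (hW.prodMk hV).aemeasurable]
    exact hgint.congr (Filter.Eventually.of_forall fun ω => (hFX ω).symm)
  have hae' : ∀ᵐ x ∂(μ.map W), ∫ v, h (glueTuple K (ρ x) v) ∂(μ.map V) = 0 := by
    have hmap : (μ.map fun ω (k : K) => X (J k) ω) = (μ.map W).map ρ := by
      rw [Measure.map_map hρ hW]; rfl
    rw [hmap] at hae
    exact ae_of_ae_map hρ.aemeasurable hae
  calc _ = ∫ x, g x.1 * h (glueTuple K (ρ x.1) x.2) ∂((μ.map W).prod (μ.map V)) := by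
        rw [← hprod, integral_map (hW.prodMk hV).aemeasurable hF.aestronglyMeasurable]
        exact integral_congr_ae (Filter.Eventually.of_forall fun ω => (hFX ω).symm)
    _ = ∫ x, g x * ∫ v, h (glueTuple K (ρ x) v) ∂(μ.map V) ∂(μ.map W) := by
        rw [integral_prod _ hI]
        exact integral_congr_ae (Filter.Eventually.of_forall fun x => by
          dsimp only; rw [integral_const_mul])
    _ = 0 := by
        rw [integral_congr_ae (g := fun _ => (0 : ℝ)) (by
          filter_upwards [hae'] with x hx
          rw [hx, mul_zero])]
        simp

end Vanishing

/-! ### Moments of the increments. -/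

/-- AM-GM with equal weights. It takes the place of Hölder's inequality for products of identically
distributed factors, and needs no independence. -/
theorem Real.abs_prod_le_sum_abs_pow {p : ℕ} (hp : 0 < p) (y : Fin p → ℝ) :
    |∏ a, y a| ≤ ∑ a, (p : ℝ)⁻¹ * |y a| ^ p := by
  have h := Real.geom_mean_le_arith_mean_weighted Finset.univ (fun _ : Fin p => (p : ℝ)⁻¹)
    (fun a => |y a| ^ p) (fun _ _ => by positivity)
    (by simp [hp.ne']) (fun _ _ => by positivity)
  refine le_trans (le_of_eq ?_) h
  rw [Finset.abs_prod]
  exact Finset.prod_congr rfl fun a _ => (Real.pow_rpow_inv_natCast (abs_nonneg _) hp.ne').symm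

theorem uStat_eq_sum_strictTuples {Ω S : Type*} {r : ℕ} (h : (Fin r → S) → ℝ) (X : ℕ → Ω → S)
    (n : ℕ) (ω : Ω) : uStat h X n ω = ∑ J ∈ strictTuples r n, h fun k => X (J k) ω := by
  classical
  unfold uStat
  refine Finset.sum_bij (fun i _ k => (i k : ℕ)) ?_ ?_ ?_ ?_
  · intro i hi
    exact mem_strictTuples.2 ⟨fun k => (i k).2, (Finset.mem_filter.1 hi).2⟩
  · intro i _ j _ hij
    funext k
    exact Fin.ext (congrFun hij k)
  · intro J hJ
    rw [mem_strictTuples] at hJ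
    exact ⟨fun k => ⟨J k, hJ.1 k⟩, Finset.mem_filter.2 ⟨Finset.mem_univ _, hJ.2⟩, rfl⟩
  · intro i _
    rfl

theorem Finset.sum_pow_eq_sum_piFinset_prod {ι : Type*} [DecidableEq ι] (s : Finset ι) (p : ℕ)
    (φ : ι → ℝ) :
    (∑ J ∈ s, φ J) ^ p = ∑ f ∈ Fintype.piFinset fun _ : Fin p => s, ∏ a, φ (f a) := by
  rw [← Finset.prod_univ_sum, Finset.prod_const, Finset.card_univ, Fintype.card_fin]

theorem uStat_sub_eq_sum {Ω S : Type*} {r : ℕ} (h : (Fin r → S) → ℝ) (X : ℕ → Ω → S)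
    {a b : ℕ} (hab : a ≤ b) (ω : Ω) :
    uStat h X b ω - uStat h X a ω =
      ∑ J ∈ strictTuples r b \ strictTuples r a, h fun k => X (J k) ω := by
  classical
  rw [uStat_eq_sum_strictTuples, uStat_eq_sum_strictTuples,
    ← Finset.sum_sdiff (strictTuples_mono r hab), add_sub_cancel_right]

theorem injective_of_mem_piFinset {p r a b : ℕ} {f : Fin p → Fin r → ℕ}
    (hf : f ∈ Fintype.piFinset fun _ => strictTuples r b \ strictTuples r a) (c : Fin p) :
    (f c).Injective :=
  (mem_strictTuples.1 (Finset.mem_sdiff.1 (Fintype.mem_piFinset.1 hf c)).1).2.injective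

theorem IsIIDSeq.measurable_kernel {Ω S : Type*} [MeasurableSpace Ω] [MeasurableSpace S]
    {μ : Measure Ω} {X : ℕ → Ω → S} {r : ℕ} {h : (Fin r → S) → ℝ} (hX : IsIIDSeq μ X)
    (hh : Measurable h) (J : Fin r → ℕ) :
    Measurable fun ω => h fun k => X (J k) ω := hh.comp (hX.measurable_tuple J)

section Moments

variable {Ω S : Type*} [MeasurableSpace Ω] [MeasurableSpace S] {μ : Measure Ω}
  [IsProbabilityMeasure μ] {X : ℕ → Ω → S} {r : ℕ} {h : (Fin r → S) → ℝ}

theorem IsIIDSeq.integrable_abs_kernel_pow (hX : IsIIDSeq μ X) (hh : Measurable h) {p : ℕ}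
    (hp : Integrable (fun ω => |firstValue h X ω| ^ p) μ) {J : Fin r → ℕ} (hJ : J.Injective) :
    Integrable (fun ω => |h fun k => X (J k) ω| ^ p) μ :=
  ((hX.identDistrib_kernel hh hJ).comp
    (u := fun y : ℝ => |y| ^ p) (by fun_prop)).integrable_iff.2 hp

theorem IsIIDSeq.integral_abs_kernel_pow (hX : IsIIDSeq μ X) (hh : Measurable h) (p : ℕ)
    {J : Fin r → ℕ} (hJ : J.Injective) :
    ∫ ω, |h fun k => X (J k) ω| ^ p ∂μ = ∫ ω, |firstValue h X ω| ^ p ∂μ :=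
  ((hX.identDistrib_kernel hh hJ).comp (u := fun y : ℝ => |y| ^ p) (by fun_prop)).integral_eq

theorem IsIIDSeq.integrable_prod_kernel (hX : IsIIDSeq μ X) (hh : Measurable h) {p : ℕ}
    (hp0 : 0 < p) (hp : Integrable (fun ω => |firstValue h X ω| ^ p) μ) {f : Fin p → Fin r → ℕ}
    (hf : ∀ a, (f a).Injective) : Integrable (fun ω => ∏ a, h fun k => X (f a k) ω) μ := by
  refine Integrable.mono' (g := fun ω => ∑ a, (p : ℝ)⁻¹ * |h fun k => X (f a k) ω| ^ p) ?_ ?_ ?_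
  · exact integrable_finsetSum _ fun a _ =>
      (hX.integrable_abs_kernel_pow hh hp (hf a)).const_mul _
  · exact (Finset.measurable_prod _ fun a _ => hX.measurable_kernel hh (f a)).aestronglyMeasurable
  · exact Filter.Eventually.of_forall fun ω => Real.abs_prod_le_sum_abs_pow hp0 _

theorem IsIIDSeq.integral_prod_abs_kernel_le (hX : IsIIDSeq μ X) (hh : Measurable h) {p : ℕ}
    (hp0 : 0 < p) (hp : Integrable (fun ω => |firstValue h X ω| ^ p) μ) {f : Fin p → Fin r → ℕ}
    (hf : ∀ a, (f a).Injective) :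
    ∫ ω, |∏ a, h fun k => X (f a k) ω| ∂μ ≤ ∫ ω, |firstValue h X ω| ^ p ∂μ := by
  have hI : ∀ a, Integrable (fun ω => (p : ℝ)⁻¹ * |h fun k => X (f a k) ω| ^ p) μ := fun a =>
    (hX.integrable_abs_kernel_pow hh hp (hf a)).const_mul _
  calc _ ≤ ∫ ω, ∑ a, (p : ℝ)⁻¹ * |h fun k => X (f a k) ω| ^ p ∂μ :=
        integral_mono (hX.integrable_prod_kernel hh hp0 hp hf).abs
          (integrable_finsetSum _ fun a _ => hI a) fun ω => Real.abs_prod_le_sum_abs_pow hp0 _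
    _ = _ := by
        rw [integral_finsetSum _ fun a _ => hI a]
        simp only [integral_const_mul, hX.integral_abs_kernel_pow hh p (hf _), Finset.sum_const,
          Finset.card_univ, Fintype.card_fin, nsmul_eq_mul]
        rw [mul_inv_cancel_left₀ (by exact_mod_cast hp0.ne')]

/-- A tuple `c` with at most `i - 1` shared positions is orthogonal to the product of the other
factors, which depends only on the variables in `otherIndices f c`. -/
theorem IsIIDSeq.integral_prod_kernel_eq_zero (hX : IsIIDSeq μ X) (hh : Measurable h)
    (hsymm : IsSymmetricKernel h) (hint : Integrable (firstValue h X) μ) {i : ℕ}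
    (hdeg : ∀ s, MeasurableSet[sigmaFirst X (i - 1)] s → ∫ ω in s, firstValue h X ω ∂μ = 0)
    {p : ℕ} (hp0 : 0 < p) (hp : Integrable (fun ω => |firstValue h X ω| ^ p) μ)
    {f : Fin p → Fin r → ℕ} (hf : ∀ a, (f a).Injective)
    (hsh : ¬ ∀ c, i ≤ (sharedPositions f c).card) :
    ∫ ω, ∏ a, h (fun k => X (f a k) ω) ∂μ = 0 := by
  push Not at hsh
  obtain ⟨c, hc⟩ := hsh
  let g : (otherIndices f c → S) → ℝ := fun x => ∏ b : {b // b ≠ c}, h fun k =>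
    x ⟨f b k, mem_otherIndices.2 ⟨b, b.2, k, rfl⟩⟩
  have hg : Measurable g := Finset.measurable_prod _ fun b _ =>
    hh.comp (measurable_pi_lambda _ fun k => measurable_pi_apply _)
  have heq : ∀ ω, ∏ a, h (fun k => X (f a k) ω) =
      g (fun j : otherIndices f c => X j ω) * h fun k => X (f c k) ω := fun ω => by
    rw [Fintype.prod_eq_mul_prod_subtype_ne _ c, mul_comm]
  have hI := hX.integrable_prod_kernel hh hp0 hp hf
  simp only [heq] at hI ⊢
  exact hX.integral_kernel_mul_eq_zero hh hsymm hint hdeg (hf c) (otherIndices f c)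
    (Nat.le_sub_one_of_lt hc) hg hI

theorem IsIIDSeq.integrable_uStat_sub_pow (hX : IsIIDSeq μ X) (hh : Measurable h) {p : ℕ}
    (hp0 : 0 < p) (hp : Integrable (fun ω => |firstValue h X ω| ^ p) μ) {a b : ℕ} (hab : a ≤ b) :
    Integrable (fun ω => (uStat h X b ω - uStat h X a ω) ^ p) μ := by
  simp only [uStat_sub_eq_sum h X hab,
    Finset.sum_pow_eq_sum_piFinset_prod]
  exact integrable_finsetSum _ fun f hf =>
    hX.integrable_prod_kernel hh hp0 hp (injective_of_mem_piFinset hf)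

/-- The even moments of the increments of a degenerate `U`-statistic. -/
theorem IsIIDSeq.integral_uStat_sub_pow_le (hX : IsIIDSeq μ X) (hh : Measurable h)
    (hsymm : IsSymmetricKernel h) (hint : Integrable (firstValue h X) μ) {i : ℕ} (hi : 0 < i)
    (hir : i ≤ r)
    (hdeg : ∀ s, MeasurableSet[sigmaFirst X (i - 1)] s → ∫ ω in s, firstValue h X ω ∂μ = 0)
    {k : ℕ} (hk : 0 < k) (hp : Integrable (fun ω => |firstValue h X ω| ^ (2 * k)) μ)
    {a b n d : ℕ} (hab : a ≤ b) (hbn : b ≤ n) (hd : b - a ≤ d) (hdn : d ≤ n)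
    (hq : 2 * k * r ≤ d) :
    ∫ ω, (uStat h X b ω - uStat h X a ω) ^ (2 * k) ∂μ ≤
      (9 ^ r * (n : ℝ) ^ (2 * r - i - 1) * d * (2 * k * r : ℝ) ^ i) ^ k *
        ∫ ω, |firstValue h X ω| ^ (2 * k) ∂μ := by
  classical
  have hp0 : 0 < 2 * k := by omega
  simp only [uStat_sub_eq_sum h X hab,
    Finset.sum_pow_eq_sum_piFinset_prod]
  rw [integral_finsetSum _ fun f hf =>
    hX.integrable_prod_kernel hh hp0 hp (injective_of_mem_piFinset hf)]
  set M := ∫ ω, |firstValue h X ω| ^ (2 * k) ∂μ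
  have hM : 0 ≤ M := integral_nonneg fun ω => by positivity
  calc _ = ∑ f ∈ sharingFamilies (2 * k) r i a b, ∫ ω, ∏ c, h (fun k => X (f c k) ω) ∂μ := by
        rw [sharingFamilies]
        refine (Finset.sum_filter_of_ne fun f hf hne => ?_).symm
        by_contra hcon
        exact hne (hX.integral_prod_kernel_eq_zero hh hsymm hint hdeg hp0 hp
          (injective_of_mem_piFinset hf) hcon)
    _ ≤ ∑ f ∈ sharingFamilies (2 * k) r i a b, M := by
        refine Finset.sum_le_sum fun f hf => ?_
        refine le_trans (le_abs_self _) (abs_integral_le_integral_abs.trans ?_)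
        exact hX.integral_prod_abs_kernel_le hh hp0 hp
          (injective_of_mem_piFinset (Finset.mem_filter.1 hf).1)
    _ = ((sharingFamilies (2 * k) r i a b).card : ℝ) * M := by
        rw [Finset.sum_const, nsmul_eq_mul]
    _ ≤ _ := by
        gcongr
        exact card_sharingFamilies_le (by omega) hab hbn hd hdn hk (by omega) hq

/-- The crude moment bound by the number of tuples. -/
theorem IsIIDSeq.integral_sum_abs_kernel_pow_le (hX : IsIIDSeq μ X) (hh : Measurable h) {p : ℕ}
    (hp0 : 0 < p) (hp : Integrable (fun ω => |firstValue h X ω| ^ p) μ) (N : ℕ) :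
    Integrable (fun ω => (∑ J ∈ strictTuples r N, |h fun k => X (J k) ω|) ^ p) μ ∧
    ∫ ω, (∑ J ∈ strictTuples r N, |h fun k => X (J k) ω|) ^ p ∂μ ≤
      ((N : ℝ) ^ r) ^ p * ∫ ω, |firstValue h X ω| ^ p ∂μ := by
  classical
  have hinj : ∀ f ∈ Fintype.piFinset fun _ : Fin p => strictTuples r N, ∀ c, (f c).Injective :=
    fun f hf c => (mem_strictTuples.1 (Fintype.mem_piFinset.1 hf c)).2.injective
  simp only [Finset.sum_pow_eq_sum_piFinset_prod, ← Finset.abs_prod]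
  have hI : ∀ f ∈ Fintype.piFinset fun _ : Fin p => strictTuples r N,
      Integrable (fun ω => |∏ c, h fun k => X (f c k) ω|) μ := fun f hf =>
    (hX.integrable_prod_kernel hh hp0 hp (hinj f hf)).abs
  refine ⟨integrable_finsetSum _ hI, ?_⟩
  rw [integral_finsetSum _ hI]
  have hM : 0 ≤ ∫ ω, |firstValue h X ω| ^ p ∂μ := integral_nonneg fun ω => by positivity
  refine (Finset.sum_le_sum fun f hf =>
    hX.integral_prod_abs_kernel_le hh hp0 hp (hinj f hf)).trans ?_
  rw [Finset.sum_const, nsmul_eq_mul, Fintype.card_piFinset]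
  gcongr
  have hc : (strictTuples r N).card ≤ N ^ r := by
    refine (Finset.card_filter_le _ _).trans ?_
    simp
  have hc' : ((strictTuples r N).card : ℝ) ≤ (N : ℝ) ^ r := by exact_mod_cast hc
  simp only [Finset.prod_const, Finset.card_univ, Fintype.card_fin]
  push_cast
  gcongr

end Moments

/-! ### Chaining and the maximal inequality. -/

/-- A dyadic chaining bound. -/
theorem abs_le_of_dyadic_increments {u : ℕ → ℝ} (hu : u 0 = 0) {q K : ℕ} {lam : ℝ}
    (hinc : ∀ l ≤ K, ∀ j < 2 ^ l,
      |u ((j + 1) * (q * 2 ^ (K - l))) - u (j * (q * 2 ^ (K - l)))| ≤ lam * (9 / 10) ^ l)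
    {l : ℕ} (hl : l ≤ K) {j : ℕ} (hj : j ≤ 2 ^ l) :
    |u (j * (q * 2 ^ (K - l)))| ≤ lam * (10 * (1 - (9 / 10) ^ (l + 1))) := by
  have hlam : 0 ≤ lam := by
    have := hinc 0 (Nat.zero_le _) 0 (by simp)
    rw [pow_zero, mul_one] at this
    exact (abs_nonneg _).trans this
  induction l generalizing j with
  | zero =>
    rw [pow_zero] at hj
    interval_cases j
    · simp only [zero_mul, hu, abs_zero]
      norm_num [hlam]
    · have := hinc 0 (Nat.zero_le _) 0 (by simp)
      simp only [zero_mul, hu, sub_zero, zero_add, pow_zero, mul_one] at this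
      norm_num
      simpa using this
  | succ l ih =>
    have hpow : 2 ^ (K - l) = 2 * 2 ^ (K - (l + 1)) := by
      rw [← pow_succ']; congr 1; omega
    have hrho : (0 : ℝ) ≤ (9 / 10) ^ (l + 1) := by positivity
    rw [pow_succ] at hj
    -- An even grid point belongs to the coarser level; an odd one is a single increment away from
    -- an even one. The bound is `lam` times the geometric sum of `(9 / 10) ^ m` over `m ≤ l`.
    rcases Nat.even_or_odd' j with ⟨m, rfl | rfl⟩
    · have h1 := ih (by omega) (j := m) (by omega)
      have h2 : 2 * m * (q * 2 ^ (K - (l + 1))) = m * (q * 2 ^ (K - l)) := by rw [hpow]; ring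
      rw [h2, pow_succ _ (l + 1)]
      nlinarith [mul_nonneg hlam hrho]
    · have h1 := ih (by omega) (j := m) (by omega)
      have h2 : m * (q * 2 ^ (K - l)) = 2 * m * (q * 2 ^ (K - (l + 1))) := by rw [hpow]; ring
      rw [h2] at h1
      have h3 := hinc (l + 1) hl (2 * m) (by rw [pow_succ]; omega)
      have h4 := abs_add_le (u ((2 * m + 1) * (q * 2 ^ (K - (l + 1))))
        - u (2 * m * (q * 2 ^ (K - (l + 1))))) (u (2 * m * (q * 2 ^ (K - (l + 1)))))
      rw [sub_add_cancel] at h4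
      refine h4.trans ((add_le_add h3 h1).trans (le_of_eq ?_))
      ring

theorem measureReal_lt_abs_le_integral_pow_div {Ω : Type*} [MeasurableSpace Ω] {μ : Measure Ω}
    [IsProbabilityMeasure μ] {Z : Ω → ℝ} {k : ℕ}
    (hZ : Integrable (fun ω => Z ω ^ (2 * k)) μ) {t : ℝ} (ht : 0 < t) :
    μ.real {ω | t < |Z ω|} ≤ (∫ ω, Z ω ^ (2 * k) ∂μ) / t ^ (2 * k) := by
  have h := mul_meas_ge_le_integral_of_nonneg (μ := μ) (f := fun ω => Z ω ^ (2 * k))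
    (Filter.Eventually.of_forall fun ω => by
      dsimp only [Pi.zero_apply]; rw [pow_mul]; positivity) hZ (t ^ (2 * k))
  rw [le_div_iff₀ (by positivity), mul_comm]
  refine le_trans (mul_le_mul_of_nonneg_left (measureReal_mono fun ω hω => ?_) (by positivity)) h
  simp only [Set.mem_ofPred_eq] at hω ⊢
  rw [← (even_two_mul k).pow_abs (Z ω)]
  gcongr

/-- A maximal inequality for processes whose increments over an interval of length `d ≥ q` have a
`2 k`-th moment of order `d ^ k`. -/
theorem measureReal_exists_lt_abs_le {Ω : Type*} [MeasurableSpace Ω] {μ : Measure Ω}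
    [IsProbabilityMeasure μ] {u : ℕ → Ω → ℝ} (hu : ∀ ω, u 0 ω = 0) {q K k : ℕ} (hq : 0 < q)
    (hk : 2 ≤ k) {H M : ℝ} (hH : 0 ≤ H) (hM : 0 ≤ M)
    (hint : ∀ a b, a ≤ b → Integrable (fun ω => (u b ω - u a ω) ^ (2 * k)) μ)
    (hmom : ∀ a b d, a ≤ b → b ≤ q * 2 ^ K → b - a ≤ d → d ≤ q * 2 ^ K → q ≤ d →
      ∫ ω, (u b ω - u a ω) ^ (2 * k) ∂μ ≤ (H * d) ^ k * M) {lam : ℝ} (hlam : 0 < lam) :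
    μ.real {ω | ∃ t < q * 2 ^ K, 11 * lam < |u t ω|} ≤
      (5 + q) * (H * (q * 2 ^ K) / lam ^ 2) ^ k * M := by
  have hq' : (0 : ℝ) < q := by exact_mod_cast hq
  set n := q * 2 ^ K with hn
  have hn' : (n : ℝ) = q * 2 ^ K := by rw [hn]; push_cast; rfl
  have hn0 : (0 : ℝ) < n := by rw [hn']; positivity
  set Q := (H * (q * 2 ^ K) / lam ^ 2) ^ k * M with hQ
  have hQ0 : 0 ≤ Q := by positivity
  let E₁ : ℕ → ℕ → Set Ω := fun l j => {ω | lam * (9 / 10) ^ l <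
    |u ((j + 1) * (q * 2 ^ (K - l))) ω - u (j * (q * 2 ^ (K - l))) ω|}
  let E₂ : ℕ → Set Ω := fun t => {ω | lam < |u t ω - u (t / q * q) ω|}
  -- Chaining to the last grid point before `t` costs at most `10 * lam`, and the remainder inside a
  -- block of length `q` costs `lam`.
  have hsub : {ω | ∃ t < n, 11 * lam < |u t ω|} ⊆
      (⋃ l ∈ Finset.range (K + 1), ⋃ j ∈ Finset.range (2 ^ l), E₁ l j) ∪
        ⋃ t ∈ Finset.range n, E₂ t := by
    rintro ω ⟨t, ht, hω⟩
    by_contra hcon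
    simp only [Set.mem_union, Set.mem_iUnion, Finset.mem_range, not_or, not_exists, E₁, E₂,
      Set.mem_ofPred_eq, not_lt] at hcon
    obtain ⟨h1, h2⟩ := hcon
    have h3 := abs_le_of_dyadic_increments (u := fun t => u t ω) (hu ω) (q := q) (K := K)
      (lam := lam) (fun l hl j hj => h1 l (by omega) j hj) le_rfl (j := t / q)
      (Nat.div_le_of_le_mul ht.le)
    rw [Nat.sub_self, pow_zero, mul_one] at h3
    have h4 := h2 t ht
    have h5 : (0 : ℝ) ≤ (9 / 10) ^ (K + 1) := by positivity
    have h6 := abs_add_le (u t ω - u (t / q * q) ω) (u (t / q * q) ω)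
    rw [sub_add_cancel] at h6
    nlinarith [mul_nonneg hlam.le h5]
  have hE₁ : ∀ l ∈ Finset.range (K + 1), ∀ j ∈ Finset.range (2 ^ l),
      μ.real (E₁ l j) ≤ Q * ((2 / 5) ^ l) := by
    intro l hl j hj
    rw [Finset.mem_range] at hl hj
    have hpow : q * 2 ^ (K - l) * 2 ^ l = n := by
      rw [mul_assoc, ← pow_add, Nat.sub_add_cancel (by omega)]
    have hpos : 0 < lam * (9 / 10) ^ l := by positivity
    have hle : j * (q * 2 ^ (K - l)) ≤ (j + 1) * (q * 2 ^ (K - l)) :=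
      Nat.mul_le_mul_right _ (by omega)
    refine (measureReal_lt_abs_le_integral_pow_div (hint _ _ hle) hpos).trans ?_
    have hm := hmom (j * (q * 2 ^ (K - l))) ((j + 1) * (q * 2 ^ (K - l))) (q * 2 ^ (K - l)) hle
      (by rw [← hpow, mul_comm]; exact Nat.mul_le_mul_left _ hj)
      (by rw [add_mul, one_mul, Nat.add_sub_cancel_left])
      (Nat.mul_le_mul_left _ (Nat.pow_le_pow_right (by norm_num) (by omega)))
      (Nat.le_mul_of_pos_right _ (by positivity))
    have hd : ((q * 2 ^ (K - l) : ℕ) : ℝ) = n / 2 ^ l := by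
      rw [eq_div_iff (by positivity)]; exact_mod_cast hpow
    rw [hd] at hm
    calc _ ≤ (H * (n / 2 ^ l)) ^ k * M / (lam * (9 / 10) ^ l) ^ (2 * k) := by gcongr
      _ = Q * (((50 / 81 : ℝ) ^ k) ^ l) := by
          rw [hQ, ← hn', pow_mul (lam * (9 / 10) ^ l), mul_pow lam, ← pow_mul, ← pow_mul,
            mul_comm k l, pow_mul _ l k, mul_comm l 2, pow_mul _ 2 l, mul_div_right_comm,
            ← div_pow, mul_right_comm _ M, ← mul_pow]
          congr 2
          have : (50 / 81 : ℝ) ^ l = 1 / (2 ^ l * ((9 / 10) ^ 2) ^ l) := by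
            rw [← mul_pow, one_div, ← inv_pow]; norm_num
          rw [this]
          field_simp
      -- Halving the length against the squared threshold ratio gives `(1 / 2) / (81 / 100) = 50 /
      -- 81`. With `k ≥ 2` the power is below `2 / 5`, so the `2 ^ l` events of level `l` sum to a
      -- convergent geometric series of ratio `4 / 5`.
      _ ≤ Q * ((2 / 5) ^ l) := by
          gcongr
          calc (50 / 81 : ℝ) ^ k ≤ (50 / 81 : ℝ) ^ 2 :=
                pow_le_pow_of_le_one (by norm_num) (by norm_num) hk
            _ ≤ 2 / 5 := by norm_num
  have hE₂ : ∀ t ∈ Finset.range n, μ.real (E₂ t) ≤ Q * (q / n) := by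
    intro t ht
    rw [Finset.mem_range] at ht
    have hle : t / q * q ≤ t := Nat.div_mul_le_self t q
    refine (measureReal_lt_abs_le_integral_pow_div (hint _ _ hle) hlam).trans ?_
    have hqn : q ≤ n := Nat.le_mul_of_pos_right _ (by positivity)
    have hm := hmom (t / q * q) t q hle ht.le
      (by have := Nat.div_add_mod t q; have := Nat.mod_lt t hq; rw [mul_comm]; omega) hqn le_rfl
    calc _ ≤ (H * q) ^ k * M / lam ^ (2 * k) := by gcongr
      _ = Q * (q / n) ^ k := by
          rw [hQ, ← hn', pow_mul, mul_right_comm _ M, ← mul_pow, mul_div_right_comm, ← div_pow]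
          congr 2
          field_simp
      -- One factor `q / n` suffices: the union over `n` times then costs `q * Q`.
      _ ≤ Q * (q / n) := by
          gcongr
          have : (q : ℝ) ≤ n := by exact_mod_cast hqn
          exact pow_le_of_le_one (by positivity) ((div_le_one hn0).2 this) (by omega)
  refine (measureReal_mono hsub).trans ((measureReal_union_le _ _).trans ?_)
  have hS₁ : μ.real (⋃ l ∈ Finset.range (K + 1), ⋃ j ∈ Finset.range (2 ^ l), E₁ l j) ≤ 5 * Q := by
    calc _ ≤ ∑ l ∈ Finset.range (K + 1), ∑ j ∈ Finset.range (2 ^ l), μ.real (E₁ l j) :=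
          (measureReal_biUnion_finset_le _ _).trans
            (Finset.sum_le_sum fun l _ => measureReal_biUnion_finset_le _ _)
      _ ≤ ∑ l ∈ Finset.range (K + 1), ∑ j ∈ Finset.range (2 ^ l), Q * ((2 / 5) ^ l) :=
          Finset.sum_le_sum fun l hl => Finset.sum_le_sum fun j hj => hE₁ l hl j hj
      _ = Q * ∑ l ∈ Finset.range (K + 1), (4 / 5 : ℝ) ^ l := by
          rw [Finset.mul_sum]
          refine Finset.sum_congr rfl fun l _ => ?_
          rw [Finset.sum_const, Finset.card_range, nsmul_eq_mul]
          push_cast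
          rw [mul_left_comm, ← mul_pow]
          norm_num
      _ ≤ Q * 5 := by
          gcongr
          rw [geom_sum_eq (by norm_num)]
          have : (0 : ℝ) ≤ (4 / 5) ^ (K + 1) := by positivity
          rw [div_le_iff_of_neg (by norm_num)]
          linarith
      _ = _ := mul_comm _ _
  have hS₂ : μ.real (⋃ t ∈ Finset.range n, E₂ t) ≤ q * Q := by
    calc _ ≤ ∑ t ∈ Finset.range n, μ.real (E₂ t) := measureReal_biUnion_finset_le _ _
      _ ≤ ∑ t ∈ Finset.range n, Q * (q / n) := Finset.sum_le_sum hE₂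
      _ = _ := by
          rw [Finset.sum_const, Finset.card_range, nsmul_eq_mul]
          field_simp
  rw [mul_assoc, ← hQ, add_mul]
  exact add_le_add hS₁ hS₂

/-! ### Tail bound at a fixed moment order. -/

theorem Nat.exists_lt_mul_two_pow_le {q N : ℕ} (hq : 0 < q) (hqN : q ≤ N) :
    ∃ K, N < q * 2 ^ K ∧ q * 2 ^ K ≤ 2 * N := by
  have hex : ∃ K, N < q * 2 ^ K :=
    ⟨N, Nat.lt_two_pow_self.trans_le (Nat.le_mul_of_pos_left _ hq)⟩
  refine ⟨Nat.find hex, Nat.find_spec hex, ?_⟩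
  have h0 : Nat.find hex ≠ 0 := fun h => by
    have := Nat.find_spec hex
    rw [h, pow_zero, mul_one] at this
    omega
  obtain ⟨K, hK⟩ := Nat.exists_eq_succ_of_ne_zero h0
  have := Nat.find_min hex (m := K) (by omega)
  rw [hK, Nat.succ_eq_add_one, pow_succ, ← mul_assoc]
  omega

theorem uStat_zero {Ω S : Type*} {r : ℕ} (hr : 0 < r) (h : (Fin r → S) → ℝ) (X : ℕ → Ω → S)
    (ω : Ω) : uStat h X 0 ω = 0 := by
  rw [uStat_eq_sum_strictTuples]
  refine Finset.sum_eq_zero fun J hJ => ?_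
  exact absurd ((mem_strictTuples.1 hJ).1 ⟨0, hr⟩) (Nat.not_lt_zero _)

section Tail

variable {Ω S : Type*} [MeasurableSpace Ω] [MeasurableSpace S] {μ : Measure Ω}
  [IsProbabilityMeasure μ] {X : ℕ → Ω → S} {r : ℕ} {h : (Fin r → S) → ℝ}

/-- The tail bound from the `2 k`-th moment of the kernel. -/
theorem IsIIDSeq.measureReal_maxAbsUStat_le (hX : IsIIDSeq μ X) (hh : Measurable h)
    (hsymm : IsSymmetricKernel h) (hint : Integrable (firstValue h X) μ) {i : ℕ} (hi : 0 < i)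
    (hir : i ≤ r)
    (hdeg : ∀ s, MeasurableSet[sigmaFirst X (i - 1)] s → ∫ ω in s, firstValue h X ω ∂μ = 0)
    {k : ℕ} (hk : 2 ≤ k) (hp : Integrable (fun ω => |firstValue h X ω| ^ (2 * k)) μ)
    {N : ℕ} (hN : r ≤ N) {x : ℝ} (hx : 0 < x) :
    μ.real {ω | maxAbsUStat h X hN ω > (N : ℝ) ^ ((r : ℝ) - (i : ℝ) / 2) * x} ≤
      (5 + 2 * k * r) * (121 * 36 ^ r * (2 * r) ^ r * k ^ i / x ^ 2) ^ k *
        ∫ ω, |firstValue h X ω| ^ (2 * k) ∂μ := by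
  have hr : 0 < r := by omega
  have hN0 : (0 : ℝ) < N := by exact_mod_cast (by omega : 0 < N)
  have hk0 : (0 : ℝ) < k := by exact_mod_cast (by omega : 0 < k)
  have hr1 : (1 : ℝ) ≤ r := by exact_mod_cast hr
  set M := ∫ ω, |firstValue h X ω| ^ (2 * k) ∂μ
  have hM : 0 ≤ M := integral_nonneg fun ω => by positivity
  set Λ := (N : ℝ) ^ ((r : ℝ) - (i : ℝ) / 2) with hΛdef
  have hΛ0 : 0 < Λ := by positivity
  have hΛ : Λ ^ 2 = (N : ℝ) ^ (2 * r - i) := by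
    rw [hΛdef, ← Real.rpow_natCast, ← Real.rpow_mul hN0.le, ← Real.rpow_natCast]
    congr 1
    rw [Nat.cast_sub (by omega)]
    push_cast
    ring
  have h2r : (2 * r : ℝ) ^ i ≤ (2 * r) ^ r := pow_le_pow_right₀ (by linarith) hir
  have hmax : ∀ ω, maxAbsUStat h X hN ω > Λ * x ↔
      ∃ n ∈ Finset.Icc r N, Λ * x < |uStat h X n ω| := fun ω => Finset.lt_sup'_iff _
  -- For large `N` chaining runs up to a dyadic multiple `n ≤ 2 * N`: the constant `121` is `11 ^
  -- 2`, and `36 ^ r` is `9 ^ r` from the count times `4 ^ r` from `n ≤ 2 * N`. For small `N`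
  -- counting all tuples gives `(N ^ i / x ^ 2) ^ k`, and `N ≤ 2 * r * k` makes this fit the same
  -- bound.
  rcases le_or_gt (2 * k * r) N with hqN | hNq
  · obtain ⟨K, hK1, hK2⟩ := Nat.exists_lt_mul_two_pow_le (q := 2 * k * r) (by positivity) hqN
    set n := 2 * k * r * 2 ^ K with hn
    have hn' : (n : ℝ) = ((2 * k * r : ℕ) : ℝ) * 2 ^ K := by rw [hn]; push_cast; ring
    have hn2 : (n : ℝ) ≤ 2 * N := by exact_mod_cast hK2
    have hmain := measureReal_exists_lt_abs_le (μ := μ) (u := uStat h X) (uStat_zero hr h X)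
      (q := 2 * k * r) (K := K) (by positivity) hk
      (H := 9 ^ r * (n : ℝ) ^ (2 * r - i - 1) * (2 * k * r : ℝ) ^ i) (M := M) (by positivity) hM
      (fun a b hab => hX.integrable_uStat_sub_pow hh (by omega) hp hab)
      (fun a b d hab hb hbd hd hqd => by
        have := hX.integral_uStat_sub_pow_le hh hsymm hint hi hir hdeg (by omega) hp hab hb hbd hd
          hqd
        rwa [mul_right_comm _ (d : ℝ)] at this)
      (lam := Λ * x / 11) (by positivity)
    refine (measureReal_mono fun ω hω => ?_).trans (hmain.trans ?_)
    · obtain ⟨t, ht, hlt⟩ := (hmax ω).1 hω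
      exact ⟨t, (Finset.mem_Icc.1 ht).2.trans_lt hK1, by rwa [mul_div_cancel₀ _ (by norm_num)]⟩
    · push_cast
      gcongr ?_ * ?_ ^ _ * _
      obtain ⟨e, he⟩ : ∃ e, 2 * r - i = e + 1 := ⟨2 * r - i - 1, by omega⟩
      rw [div_pow, mul_pow Λ x, hΛ, he, Nat.add_sub_cancel]
      have hcast : (2 * k * r * 2 ^ K : ℝ) = n := by rw [hn']; push_cast; ring
      have h4 : (2 : ℝ) ^ (e + 1) ≤ 4 ^ r := by
        rw [← he, (by norm_num : (4 : ℝ) = 2 ^ 2), ← pow_mul]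
        exact pow_le_pow_right₀ (by norm_num) (by omega)
      calc _ = 121 * 9 ^ r * ((n : ℝ) ^ (e + 1) / (N : ℝ) ^ (e + 1)) * (2 * r) ^ i * k ^ i / x ^ 2 := by
            rw [hcast, pow_succ (n : ℝ), (by ring : (2 * k * r : ℝ) = 2 * r * k), mul_pow _ (k : ℝ)]
            field_simp
            ring
        _ ≤ 121 * 9 ^ r * 4 ^ r * (2 * r) ^ r * k ^ i / x ^ 2 := by
            gcongr
            rw [div_le_iff₀ (by positivity)]
            calc (n : ℝ) ^ (e + 1) ≤ (2 * N) ^ (e + 1) := by gcongr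
              _ = 2 ^ (e + 1) * (N : ℝ) ^ (e + 1) := mul_pow _ _ _
              _ ≤ _ := by gcongr
        _ = _ := by
            rw [mul_assoc (121 : ℝ), ← mul_pow]
            norm_num
  · obtain ⟨hI, hb⟩ := hX.integral_sum_abs_kernel_pow_le hh (p := 2 * k) (by omega) hp N
    set Z := fun ω => ∑ J ∈ strictTuples r N, |h fun l => X (J l) ω|
    have hNq' : (N : ℝ) ≤ 2 * r * k := by
      have : (N : ℝ) ≤ ((2 * k * r : ℕ) : ℝ) := by exact_mod_cast hNq.le
      push_cast at this
      linarith
    calc _ ≤ μ.real {ω | Λ * x < |Z ω|} := by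
          refine measureReal_mono fun ω hω => ?_
          obtain ⟨t, ht, hlt⟩ := (hmax ω).1 hω
          refine hlt.trans_le (le_trans ?_ (le_abs_self _))
          rw [uStat_eq_sum_strictTuples]
          exact (Finset.abs_sum_le_sum_abs _ _).trans (Finset.sum_le_sum_of_subset_of_nonneg
            (strictTuples_mono r (Finset.mem_Icc.1 ht).2) fun _ _ _ => abs_nonneg _)
      _ ≤ (∫ ω, Z ω ^ (2 * k) ∂μ) / (Λ * x) ^ (2 * k) :=
          measureReal_lt_abs_le_integral_pow_div hI (by positivity)
      _ ≤ ((N : ℝ) ^ r) ^ (2 * k) * M / (Λ * x) ^ (2 * k) := by gcongr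
      _ = 1 * ((N : ℝ) ^ i / x ^ 2) ^ k * M := by
          rw [pow_mul, pow_mul (Λ * x), mul_pow Λ, hΛ, one_mul, mul_div_right_comm, ← div_pow]
          congr 2
          have : ((N : ℝ) ^ r) ^ 2 = (N : ℝ) ^ (2 * r - i) * (N : ℝ) ^ i := by
            rw [← pow_mul, ← pow_add]; congr 1; omega
          rw [this]
          field_simp
      _ ≤ _ := by
          have hkr : (0 : ℝ) ≤ 2 * k * r := by positivity
          gcongr ?_ * (?_ / _) ^ _ * _
          · linarith
          · have h36 : (1 : ℝ) ≤ 121 * 36 ^ r := by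
              have : (1 : ℝ) ≤ 36 ^ r := one_le_pow₀ (by norm_num)
              linarith
            calc (N : ℝ) ^ i ≤ (2 * r * k) ^ i := by gcongr
              _ = 1 * (2 * r) ^ i * k ^ i := by rw [mul_pow, one_mul]
              _ ≤ _ := by gcongr

end Tail

/-! ### Exponential moments and the choice of the moment order. -/

/-- With `s = 2 * k / γ` the left side is `(y ^ γ) ^ s`, and `t ≤ s * exp (t / s)` is raised to the
power `s`. -/
theorem Real.pow_le_rpow_mul_exp_rpow {y γ : ℝ} (hy : 0 ≤ y) (hγ : 0 < γ) {k : ℕ} (hk : 0 < k) :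
    y ^ (2 * k) ≤ ((2 / γ * k) ^ (2 / γ)) ^ k * Real.exp (y ^ γ) := by
  have hk' : (0 : ℝ) < k := by exact_mod_cast hk
  set s := 2 / γ * k with hs
  have hs0 : 0 < s := by positivity
  have h1 : y ^ γ ≤ s * Real.exp (y ^ γ / s) := by
    have := Real.add_one_le_exp (y ^ γ / s)
    rw [mul_comm, ← div_le_iff₀ hs0]
    linarith
  have h2 : y ^ (2 * k) = (y ^ γ) ^ s := by
    rw [← Real.rpow_mul hy, ← Real.rpow_natCast, hs]
    congr 1
    push_cast
    field_simp
  calc y ^ (2 * k) = (y ^ γ) ^ s := h2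
    _ ≤ (s * Real.exp (y ^ γ / s)) ^ s := by gcongr
    _ = _ := by
        rw [Real.mul_rpow hs0.le (Real.exp_pos _).le, ← Real.exp_mul, div_mul_cancel₀ _ hs0.ne',
          ← Real.rpow_natCast (s ^ (2 / γ)), ← Real.rpow_mul hs0.le]

theorem mainTheorem3 (C : ℕ → ℝ) (hC : ∀ r, 0 < C r) (r : ℕ) (hr : 1 ≤ r) (γ : ℝ) (hγ : 0 < γ) :
    ∃ A B : ℝ, 0 < A ∧ 0 < B ∧
      ∀ (Ω S : Type*) [MeasurableSpace Ω] [MeasurableSpace S]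
        (μ : Measure Ω) [IsProbabilityMeasure μ]
        (h : (Fin r → S) → ℝ) (_ : Measurable h) (_ : IsSymmetricKernel h)
        (X : ℕ → Ω → S) (_ : IsIIDSeq μ X)
        (i : ℕ) (_ : 2 ≤ i) (_ : i ≤ r) (_ : IsDegenerateOfOrder μ X h (i - 1))
        (x : ℝ) (_ : xThreshold (C r) r i γ ≤ x) (N : ℕ) (hN : r ≤ N),
        μ {ω | maxAbsUStat h X hN ω > (N : ℝ) ^ ((r : ℝ) - (i : ℝ) / 2) * x} ≤
          ENNReal.ofReal (A * Real.exp (-(B * x ^ (2 * γ / ((i : ℝ) * γ + 2))))) *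
            ∫⁻ ω, ENNReal.ofReal (Real.exp (|firstValue h X ω| ^ γ)) ∂μ := by
  have hr1 : (1 : ℝ) ≤ r := by exact_mod_cast hr
  set D : ℝ := 121 * 36 ^ r * (2 * r) ^ r * (2 / γ) ^ (2 / γ) with hD
  have hD0 : 0 < D := by positivity
  -- The second entry brings the base of the `k`-th power below `exp (-2)`; the first gives `c ^ (i
  -- + 2 / γ) ≤ c`, so that one `c` serves all `i`.
  set c : ℝ := min 1 (Real.exp (-2) / D) with hc
  have hc0 : 0 < c := lt_min one_pos (by positivity)
  have hc1 : c ≤ 1 := min_le_left _ _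
  have hcD : D * c ≤ Real.exp (-2) := by
    rw [mul_comm, ← le_div_iff₀ hD0]
    exact min_le_right _ _
  refine ⟨(5 + 2 * r) * Real.exp 2, c, by positivity, hc0, ?_⟩
  intro Ω S _ _ μ _ h hh hsymm X hX i hi hir hdeg x hx N hN
  -- The threshold serves to make `x` positive; small values of `x` are absorbed by the factor `exp
  -- 2` in `A`.
  have hx0 : 0 < x := lt_of_lt_of_le (by have := hC r; unfold xThreshold; positivity) hx
  set α := 2 * γ / ((i : ℝ) * γ + 2) with hα
  set T := c * x ^ α with hT
  have hT0 : 0 < T := by positivity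
  have hexpm : Measurable fun ω => Real.exp (|firstValue h X ω| ^ γ) := by
    have : Measurable (firstValue h X) := hX.measurable_kernel hh fun k => (k : ℕ)
    fun_prop
  rcases eq_or_ne (∫⁻ ω, ENNReal.ofReal (Real.exp (|firstValue h X ω| ^ γ)) ∂μ) ⊤ with htop | hfin
  · rw [htop, ENNReal.mul_top (by rw [Ne, ENNReal.ofReal_eq_zero, not_le]; positivity)]
    exact le_top
  have hexpI : Integrable (fun ω => Real.exp (|firstValue h X ω| ^ γ)) μ :=
    (lintegral_ofReal_ne_top_iff_integrable hexpm.aestronglyMeasurable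
      (Filter.Eventually.of_forall fun ω => (Real.exp_pos _).le)).1 hfin
  rw [← ofReal_integral_eq_lintegral_ofReal hexpI
    (Filter.Eventually.of_forall fun ω => (Real.exp_pos _).le),
    ← ENNReal.ofReal_mul (by positivity), ← ofReal_measureReal]
  refine ENNReal.ofReal_le_ofReal ?_
  set E := ∫ ω, Real.exp (|firstValue h X ω| ^ γ) ∂μ
  have hE1 : 1 ≤ E := by
    have := integral_mono (μ := μ) (integrable_const (1 : ℝ)) hexpI fun ω =>
      Real.one_le_exp (by positivity)
    simpa using this
  -- For `T < 2` the right side is at least one. Otherwise `⌊T⌋₊ ≥ 2`, as the chaining requires.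
  rcases lt_or_ge T 2 with hT2 | hT2
  · calc _ ≤ (1 : ℝ) := measureReal_le_one
      _ ≤ ((5 + 2 * r) * (Real.exp 2 * Real.exp (-T))) * E := by
          rw [← Real.exp_add]
          have h1 : 1 ≤ Real.exp (2 + -T) := Real.one_le_exp (by linarith)
          exact one_le_mul_of_one_le_of_one_le
            (one_le_mul_of_one_le_of_one_le (by linarith) h1) hE1
      _ = _ := by rw [hT]; ring
  set k := ⌊T⌋₊ with hkdef
  have hk2 : 2 ≤ k := Nat.le_floor (by exact_mod_cast hT2)
  have hkT : (k : ℝ) ≤ T := Nat.floor_le hT0.le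
  have hTk : T < k + 1 := Nat.lt_floor_add_one T
  have hk0 : (0 : ℝ) < k := by exact_mod_cast (by omega : 0 < k)
  have hpow : ∀ ω, |firstValue h X ω| ^ (2 * k) ≤
      ((2 / γ * k) ^ (2 / γ)) ^ k * Real.exp (|firstValue h X ω| ^ γ) := fun ω =>
    Real.pow_le_rpow_mul_exp_rpow (abs_nonneg _) hγ (by omega)
  have hpI : Integrable (fun ω => |firstValue h X ω| ^ (2 * k)) μ := by
    refine (hexpI.const_mul (((2 / γ * k) ^ (2 / γ)) ^ k)).mono' ?_
      (Filter.Eventually.of_forall fun ω => ?_)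
    · have : Measurable (firstValue h X) := hX.measurable_kernel hh fun k => (k : ℕ)
      exact (by fun_prop : Measurable fun ω => |firstValue h X ω| ^ (2 * k)).aestronglyMeasurable
    · rw [Real.norm_of_nonneg (by positivity)]
      exact hpow ω
  have hM : ∫ ω, |firstValue h X ω| ^ (2 * k) ∂μ ≤ ((2 / γ * k) ^ (2 / γ)) ^ k * E := by
    rw [← integral_const_mul]
    exact integral_mono hpI (hexpI.const_mul _) hpow
  have hle : sigmaFirst X (i - 1) ≤ ‹MeasurableSpace Ω› :=
    iSup_le fun j => (hX.measurable j).comap_le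
  have hdeg' : ∀ s, MeasurableSet[sigmaFirst X (i - 1)] s →
      ∫ ω in s, firstValue h X ω ∂μ = 0 := fun s hs => by
    rw [← setIntegral_condExp hle hdeg.integrable hs,
      integral_congr_ae (ae_restrict_of_ae hdeg.condExp_eq_zero)]
    simp
  have htail := hX.measureReal_maxAbsUStat_le hh hsymm hdeg.integrable (by omega) hir hdeg' hk2 hpI
    hN hx0
  have hbase : 121 * 36 ^ r * (2 * r) ^ r * k ^ i / x ^ 2 * (2 / γ * k) ^ (2 / γ)
      ≤ Real.exp (-2) := by
    have hi0 : (0 : ℝ) ≤ i := Nat.cast_nonneg i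
    have hi1 : (1 : ℝ) ≤ i := by exact_mod_cast (by omega : 1 ≤ i)
    -- The exponent `α` is determined by `α * (i + 2 / γ) = 2`.
    have hkk : (k : ℝ) ^ ((i : ℝ) + 2 / γ) ≤ c * x ^ 2 := by
      calc (k : ℝ) ^ ((i : ℝ) + 2 / γ) ≤ T ^ ((i : ℝ) + 2 / γ) := by gcongr
        _ = c ^ ((i : ℝ) + 2 / γ) * x ^ 2 := by
            rw [hT, Real.mul_rpow hc0.le (by positivity), ← Real.rpow_mul hx0.le,
              ← Real.rpow_natCast x 2]
            congr 2
            rw [hα]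
            push_cast
            field_simp
        _ ≤ c * x ^ 2 := by
            gcongr
            have hg : 0 < 2 / γ := by positivity
            calc c ^ ((i : ℝ) + 2 / γ) ≤ c ^ (1 : ℝ) :=
                  Real.rpow_le_rpow_of_exponent_ge hc0 hc1 (by linarith)
              _ = c := Real.rpow_one c
    calc _ = D * (k : ℝ) ^ ((i : ℝ) + 2 / γ) / x ^ 2 := by
          rw [hD, Real.mul_rpow (by positivity) hk0.le, Real.rpow_add hk0, Real.rpow_natCast]
          ring
      _ ≤ D * (c * x ^ 2) / x ^ 2 := by gcongr
      _ = D * c := by field_simp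
      _ ≤ _ := hcD
  have hkexp : (k : ℝ) ≤ Real.exp k := by linarith [Real.add_one_le_exp (k : ℝ)]
  have hone : 1 ≤ Real.exp (k : ℝ) := Real.one_le_exp hk0.le
  calc _ ≤ (5 + 2 * k * r) * (121 * 36 ^ r * (2 * r) ^ r * k ^ i / x ^ 2) ^ k *
        (((2 / γ * k) ^ (2 / γ)) ^ k * E) := htail.trans (by gcongr)
    _ = (5 + 2 * k * r) *
        (121 * 36 ^ r * (2 * r) ^ r * k ^ i / x ^ 2 * (2 / γ * k) ^ (2 / γ)) ^ k * E := by
        rw [mul_pow _ ((2 / γ * k) ^ (2 / γ))]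
        ring
    -- Half of the decay `exp (-2 * k)` pays for the linear factor in `k`; the rest becomes `exp
    -- (-T)` since `k > T - 1`.
    _ ≤ ((5 + 2 * r) * Real.exp k) * Real.exp (-2) ^ k * E := by
        gcongr
        nlinarith
    _ = (5 + 2 * r) * Real.exp (-k) * E := by
        rw [← Real.exp_nat_mul, mul_assoc _ (Real.exp k), ← Real.exp_add]
        congr 3
        ring
    _ ≤ (5 + 2 * r) * Real.exp (2 + -T) * E := by
        gcongr
        linarith
    _ = _ := by rw [Real.exp_add, hT]; ring
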